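/- Let $X$ be a real Banach space and let $N_X\subset X$ be a net in $X$, that is, there exist $\varepsilon,\delta>0$ such that every $x\in X$ satisfies $\|x-y\|\le\varepsilon$ for some $y\in N_X$, and $\|x-y\|\ge\delta$ for all distinct $x,y\in N_X$. For a metric space $M$ with a designated base point $o\in M$, let $\mathrm{Lip}_0(M)$ be the Banach space of all Lipschitz functions $f:M\to\mathbb{R}$ with $f(o)=0$, normed by the best Lipschitz constant $\sup\{(f(x)-f(y))/d(x,y): x\ne y\in M\}$ (read as $0$ if $M$ has only one point). Then, for every choice of base points in $X$ and in $N_X$ (with the metric inherited from $X$), $\mathrm{Lip}_0(X)$ is linearly isomorphic to a complemented subspace of $\mathrm{Lip}_0(N_X)$, i.e. there are a subspace $V\subset\mathrm{Lip}_0(N_X)$ that is the range of a bounded linear projection on $\mathrm{Lip}_0(N_X)$ and a linear homeomorphism from $\mathrm{Lip}_0(X)$ onto $V$. -/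

import Mathlib

open scoped NNReal

/-- A subset `N` of a metric space `M` is a net in `M` if, for some `ε, δ > 0`, it is
`ε`-dense in `M` and `δ`-separated. -/
def IsNet {M : Type*} [MetricSpace M] (N : Set M) : Prop :=
  ∃ ε δ : ℝ, 0 < ε ∧ 0 < δ ∧
    (∀ x : M, ∃ y ∈ N, dist x y ≤ ε) ∧
    (∀ x ∈ N, ∀ y ∈ N, x ≠ y → δ ≤ dist x y)

/-- The vector space of real-valued Lipschitz functions on `M` vanishing at the base point `o`,
as a linear subspace of the space of all functions `M → ℝ`. -/
def lipZeroSubmodule (M : Type*) [MetricSpace M] (o : M) : Submodule ℝ (M → ℝ) where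
  carrier := {f | (∃ K : ℝ≥0, LipschitzWith K f) ∧ f o = 0}
  zero_mem' := ⟨⟨0, LipschitzWith.const 0⟩, rfl⟩
  add_mem' := by
    rintro f g ⟨⟨K, hK⟩, hf⟩ ⟨⟨L, hL⟩, hg⟩
    exact ⟨⟨K + L, hK.add hL⟩, by simp [hf, hg]⟩
  smul_mem' := by
    rintro c f ⟨⟨K, hK⟩, hf⟩
    refine ⟨⟨‖c‖₊ * K, LipschitzWith.of_dist_le_mul fun x y => ?_⟩, by simp [hf]⟩
    have h := hK.dist_le_mul x y
    simp only [Pi.smul_apply, dist_smul₀, NNReal.coe_mul, coe_nnnorm, mul_assoc]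
    exact mul_le_mul_of_nonneg_left h (norm_nonneg c)

/-- The Lipschitz space `Lip₀(M)` of the pointed metric space `(M, o)`. It is a type synonym of
`lipZeroSubmodule M o`, so that it carries the topology of the Lipschitz norm and not the
topology of pointwise convergence. -/
def LipZero (M : Type*) [MetricSpace M] (o : M) : Type _ := ↥(lipZeroSubmodule M o)

namespace LipZero

variable {M : Type*} [MetricSpace M] {o : M}

instance : AddCommGroup (LipZero M o) := inferInstanceAs (AddCommGroup ↥(lipZeroSubmodule M o))

instance : Module ℝ (LipZero M o) := inferInstanceAs (Module ℝ ↥(lipZeroSubmodule M o))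

instance : CoeFun (LipZero M o) fun _ => M → ℝ := ⟨fun f => f.1⟩

/-- The Lipschitz norm: the best Lipschitz constant of `f`. The pairs `(x, x)` contribute
`0 / 0 = 0`, which does not change the supremum, and makes it `0` on a one-point space. -/
noncomputable instance : Norm (LipZero M o) :=
  ⟨fun f => ⨆ p : M × M, (f p.1 - f p.2) / dist p.1 p.2⟩

theorem norm_def (f : LipZero M o) :
    ‖f‖ = ⨆ p : M × M, (f p.1 - f p.2) / dist p.1 p.2 := rfl

theorem ext {f g : LipZero M o} (h : ∀ x, f x = g x) : f = g := Subtype.ext (funext h)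

theorem apply_base (f : LipZero M o) : f o = 0 := f.2.2

theorem add_apply (f g : LipZero M o) (x : M) : (f + g) x = f x + g x := rfl

theorem smul_apply (c : ℝ) (f : LipZero M o) (x : M) : (c • f) x = c * f x := rfl

theorem zero_apply (x : M) : (0 : LipZero M o) x = 0 := rfl

theorem bddAbove (f : LipZero M o) :
    BddAbove (Set.range fun p : M × M => (f p.1 - f p.2) / dist p.1 p.2) := by
  obtain ⟨⟨K, hK⟩, -⟩ := f.2
  refine ⟨K, ?_⟩
  rintro _ ⟨p, rfl⟩
  refine div_le_of_le_mul₀ dist_nonneg K.2 ?_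
  exact (le_abs_self _).trans (hK.dist_le_mul p.1 p.2)

theorem norm_nonneg' (f : LipZero M o) : 0 ≤ ‖f‖ := by
  have h := le_ciSup f.bddAbove (o, o)
  simpa [norm_def] using h

theorem sub_le (f : LipZero M o) (x y : M) : f x - f y ≤ ‖f‖ * dist x y := by
  rcases eq_or_ne x y with rfl | h
  · simp
  · exact (div_le_iff₀ (dist_pos.2 h)).1 (le_ciSup f.bddAbove (x, y))

theorem abs_sub_le (f : LipZero M o) (x y : M) : |f x - f y| ≤ ‖f‖ * dist x y := by
  refine abs_le'.2 ⟨f.sub_le x y, ?_⟩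
  rw [neg_sub, dist_comm]
  exact f.sub_le y x

theorem norm_le {f : LipZero M o} {C : ℝ} (hC : 0 ≤ C)
    (h : ∀ x y, |f x - f y| ≤ C * dist x y) : ‖f‖ ≤ C := by
  have : Nonempty (M × M) := ⟨(o, o)⟩
  exact ciSup_le fun p =>
    div_le_of_le_mul₀ dist_nonneg hC ((le_abs_self _).trans (h p.1 p.2))

theorem norm_smul_le' (c : ℝ) (f : LipZero M o) : ‖c • f‖ ≤ |c| * ‖f‖ := by
  refine norm_le (mul_nonneg (abs_nonneg c) f.norm_nonneg') fun x y => ?_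
  rw [smul_apply, smul_apply, ← mul_sub, abs_mul, mul_assoc]
  exact mul_le_mul_of_nonneg_left (f.abs_sub_le x y) (abs_nonneg c)

theorem norm_core : NormedSpace.Core ℝ (LipZero M o) where
  norm_nonneg := norm_nonneg'
  norm_smul c f := by
    refine le_antisymm (norm_smul_le' c f) ?_
    rcases eq_or_ne c 0 with rfl | hc
    · simpa using norm_nonneg' ((0 : ℝ) • f)
    · have h := norm_smul_le' c⁻¹ (c • f)
      rw [smul_smul, inv_mul_cancel₀ hc, one_smul, abs_inv] at h
      have hpos : 0 < |c| := abs_pos.2 hc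
      rw [Real.norm_eq_abs]
      calc |c| * ‖f‖ ≤ |c| * (|c|⁻¹ * ‖c • f‖) := mul_le_mul_of_nonneg_left h hpos.le
        _ = ‖c • f‖ := by rw [← mul_assoc, mul_inv_cancel₀ hpos.ne', one_mul]
  norm_triangle f g := by
    refine norm_le (add_nonneg f.norm_nonneg' g.norm_nonneg') fun x y => ?_
    rw [add_apply, add_apply, add_sub_add_comm, add_mul]
    exact (abs_add_le _ _).trans (add_le_add (f.abs_sub_le x y) (g.abs_sub_le x y))
  norm_eq_zero_iff f := by
    refine ⟨fun h => ext fun x => ?_, ?_⟩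
    · have hx := f.abs_sub_le x o
      rw [h, zero_mul, apply_base, sub_zero] at hx
      exact abs_eq_zero.1 (le_antisymm hx (abs_nonneg _))
    · rintro rfl
      exact le_antisymm (norm_le le_rfl fun x y => by simp [zero_apply]) (norm_nonneg' _)

noncomputable instance : NormedAddCommGroup (LipZero M o) := NormedAddCommGroup.ofCore norm_core

noncomputable instance : NormedSpace ℝ (LipZero M o) := NormedSpace.ofCore norm_core

end LipZero

/-!
The space `Lip₀(X)` is a retract of `Lip₀(N)`: there are bounded operators
`T : Lip₀(X) → Lip₀(N)` and `S : Lip₀(N) → Lip₀(X)` with `S ∘ T = id`, and then `T` is an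
isomorphism onto its range, onto which `T ∘ S` projects
(`ContinuousLinearMap.exists_closedComplemented_of_leftInverse`).

The net is coarse, so it determines a Lipschitz function on `X` only at large scales. Hence `T`
writes down magnified copies of `f`: for a unit vector `e`, the balls around `4 ^ (k + 1) • e` of
radius `2 * 4 ^ k` are pairwise disjoint, and on the concentric ball of half that radius `T f` is
`y ↦ 2 ^ k * f (p + 2⁻ᵏ • (y - 4 ^ (k + 1) • e))`. Magnifying by `2 ^ k` in both the domain and the
range does not change the Lipschitz constant, and a radial cutoff makes each copy vanish outside its
ball, at the cost of a factor `3` (`abs_magnifiedCopy_sub_le`); as the balls are disjoint, gluing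
costs another factor `2` (`abs_gluedCopies_sub_le`).

The operator `S` recovers `f` by an ultralimit of the copies, read off at the points of the net:
`S g x` is the limit of `(g (r k x) - g (r k p)) / 2 ^ k`, where `r k x` is a point of the net within
`ε` of `4 ^ (k + 1) • e + 2 ^ k • (x - p)` (`ultralimitDiff`). The distance `ε` becomes `ε / 2 ^ k`
after rescaling, so it disappears in the limit, both in the bound of the Lipschitz constant of `S g`
and in the identity `S (T f) = f`; the latter uses that `2 ^ k * ‖x - p‖ + ε ≤ 4 ^ k` for large `k`.
-/

open Filter Topology

/-! ### Complemented ranges -/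

theorem ContinuousLinearMap.exists_closedComplemented_of_leftInverse {E F : Type*}
    [NormedAddCommGroup E] [NormedSpace ℝ E] [NormedAddCommGroup F] [NormedSpace ℝ F]
    (T : E →L[ℝ] F) (S : F →L[ℝ] E) (h : ∀ x, S (T x) = x) :
    ∃ V : Submodule ℝ F, V.ClosedComplemented ∧ Nonempty (E ≃L[ℝ] V) := by
  let T' : E →L[ℝ] LinearMap.range T.toLinearMap :=
    T.codRestrict _ fun x => LinearMap.mem_range_self T.toLinearMap x
  refine ⟨LinearMap.range T.toLinearMap, ⟨T'.comp S, ?_⟩,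
    ⟨ContinuousLinearEquiv.equivOfInverse T' (S.comp (Submodule.subtypeL _)) h ?_⟩⟩
  all_goals
    rintro ⟨_, x, rfl⟩
    exact Subtype.ext (congrArg T (h x))

/-! ### Operators between Lipschitz spaces -/

namespace LipZero

variable {M M' : Type*} [MetricSpace M] [MetricSpace M'] {o : M}

/-- The element of `Lip₀(M)` obtained from a Lipschitz function by subtracting its value at the base
point. -/
def ofLipschitz (o : M) (u : M → ℝ) (hu : ∃ K : ℝ≥0, LipschitzWith K u) : LipZero M o :=
  (⟨fun x => u x - u o, by
    obtain ⟨K, hK⟩ := hu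
    exact ⟨⟨K, LipschitzWith.of_dist_le_mul fun x y => by
      simpa using hK.dist_le_mul x y⟩, sub_self _⟩⟩ : ↥(lipZeroSubmodule M o))

theorem ofLipschitz_apply (u : M → ℝ) (hu : ∃ K : ℝ≥0, LipschitzWith K u) (x : M) :
    ofLipschitz o u hu x = u x - u o := rfl

/-- A linear map from `Lip₀(M)` to functions on `M'` that multiplies Lipschitz constants by at
most `C` induces a bounded operator into `Lip₀(M')`, by subtracting values at the base point. -/
noncomputable def operatorOfBound (o' : M') (A : LipZero M o →ₗ[ℝ] (M' → ℝ)) (C : ℝ) (hC : 0 ≤ C)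
    (hA : ∀ f x y, |A f x - A f y| ≤ C * ‖f‖ * dist x y) : LipZero M o →L[ℝ] LipZero M' o' :=
  LinearMap.mkContinuous
    { toFun f := ofLipschitz o' (A f)
        ⟨⟨C * ‖f‖, mul_nonneg hC (norm_nonneg' f)⟩, LipschitzWith.of_dist_le_mul (hA f)⟩
      map_add' f g := ext fun x => by
        simp only [add_apply, ofLipschitz_apply, map_add, Pi.add_apply]
        ring
      map_smul' c f := ext fun x => by
        simp only [smul_apply, ofLipschitz_apply, map_smul, Pi.smul_apply, smul_eq_mul,
          RingHom.id_apply]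
        ring }
    C fun f => norm_le (mul_nonneg hC (norm_nonneg' f)) fun x y => by
      simpa [ofLipschitz_apply] using hA f x y

theorem operatorOfBound_apply (o' : M') (A : LipZero M o →ₗ[ℝ] (M' → ℝ)) (C : ℝ) (hC : 0 ≤ C)
    (hA : ∀ f x y, |A f x - A f y| ≤ C * ‖f‖ * dist x y) (f : LipZero M o) (x : M') :
    operatorOfBound o' A C hC hA f x = A f x - A f o' := rfl

end LipZero

/-! ### Ultralimits of rescaled differences -/

theorem Ultrafilter.exists_tendsto_of_bounded {α : Type*} (U : Ultrafilter α) {a : α → ℝ} {C : ℝ}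
    (h : ∀ k, |a k| ≤ C) : ∃ l, Tendsto a U (𝓝 l) := by
  obtain ⟨l, -, hl⟩ := (isCompact_Icc (a := -C) (b := C)).ultrafilter_le_nhds (U.map a)
    (le_principal_iff.2 (mem_map.2 (Eventually.of_forall fun k => abs_le.1 (h k))))
  exact ⟨l, hl⟩

section Ultralimit

variable {M M' : Type*} [MetricSpace M] [MetricSpace M'] {o : M}
  {r : ℕ → M' → M} {s : ℕ → ℝ} {D : ℝ} {p : M'}

theorem abs_rescaledDiff_le (hs : ∀ k, 1 ≤ s k)
    (hr : ∀ k x y, dist (r k x) (r k y) ≤ s k * dist x y + D) (g : LipZero M o) (k : ℕ) (x y : M') :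
    |(g (r k x) - g (r k y)) / s k| ≤ ‖g‖ * (dist x y + D / s k) := by
  have hk : 0 < s k := zero_lt_one.trans_le (hs k)
  rw [abs_div, abs_of_pos hk, div_le_iff₀ hk]
  calc |g (r k x) - g (r k y)| ≤ ‖g‖ * dist (r k x) (r k y) := g.abs_sub_le _ _
    _ ≤ ‖g‖ * (s k * dist x y + D) := mul_le_mul_of_nonneg_left (hr k x y) g.norm_nonneg'
    _ = ‖g‖ * (dist x y + D / s k) * s k := by field_simp

theorem exists_tendsto_rescaledDiff (hs : ∀ k, 1 ≤ s k) (hD : 0 ≤ D)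
    (hr : ∀ k x y, dist (r k x) (r k y) ≤ s k * dist x y + D) (g : LipZero M o) (x : M') :
    ∃ l, Tendsto (fun k => (g (r k x) - g (r k p)) / s k) (hyperfilter ℕ : Filter ℕ) (𝓝 l) := by
  refine (hyperfilter ℕ).exists_tendsto_of_bounded (C := ‖g‖ * (dist x p + D)) fun k => ?_
  refine (abs_rescaledDiff_le hs hr g k x p).trans ?_
  exact mul_le_mul_of_nonneg_left (add_le_add_right (div_le_self hD (hs k)) _) g.norm_nonneg'

/-- The function `x ↦ lim (g (r k x) - g (r k p)) / s k`, with the limit taken along a fixed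
nonprincipal ultrafilter, as a linear function of `g`. The limit exists because
`r k` expands distances at most `s k` times, up to an additive constant. -/
noncomputable def ultralimitDiff (p : M') (hs : ∀ k, 1 ≤ s k) (hD : 0 ≤ D)
    (hr : ∀ k x y, dist (r k x) (r k y) ≤ s k * dist x y + D) :
    LipZero M o →ₗ[ℝ] (M' → ℝ) where
  toFun g x := (exists_tendsto_rescaledDiff (p := p) hs hD hr g x).choose
  map_add' f g := funext fun x => by
    refine tendsto_nhds_unique (exists_tendsto_rescaledDiff hs hD hr (f + g) x).choose_spec
      (((exists_tendsto_rescaledDiff hs hD hr f x).choose_spec.add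
        (exists_tendsto_rescaledDiff hs hD hr g x).choose_spec).congr fun k => ?_)
    simp only [LipZero.add_apply]
    ring
  map_smul' c f := funext fun x => by
    refine tendsto_nhds_unique (exists_tendsto_rescaledDiff hs hD hr (c • f) x).choose_spec
      (((exists_tendsto_rescaledDiff hs hD hr f x).choose_spec.const_mul c).congr fun k => ?_)
    simp only [LipZero.smul_apply]
    ring

theorem tendsto_ultralimitDiff (hs : ∀ k, 1 ≤ s k) (hD : 0 ≤ D)
    (hr : ∀ k x y, dist (r k x) (r k y) ≤ s k * dist x y + D) (g : LipZero M o) (x : M') :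
    Tendsto (fun k => (g (r k x) - g (r k p)) / s k) (hyperfilter ℕ : Filter ℕ)
      (𝓝 (ultralimitDiff p hs hD hr g x)) :=
  (exists_tendsto_rescaledDiff hs hD hr g x).choose_spec

theorem abs_ultralimitDiff_sub_le (hs : ∀ k, 1 ≤ s k) (hs' : Tendsto s atTop atTop) (hD : 0 ≤ D)
    (hr : ∀ k x y, dist (r k x) (r k y) ≤ s k * dist x y + D) (g : LipZero M o) (x y : M') :
    |ultralimitDiff p hs hD hr g x - ultralimitDiff p hs hD hr g y| ≤ 1 * ‖g‖ * dist x y := by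
  have hlim : Tendsto (fun k => ‖g‖ * (dist x y + D / s k)) (hyperfilter ℕ : Filter ℕ)
      (𝓝 (‖g‖ * (dist x y + 0))) :=
    ((tendsto_const_nhds.add (tendsto_const_nhds.div_atTop hs')).const_mul _).mono_left
      Nat.hyperfilter_le_atTop
  rw [one_mul, ← add_zero (dist x y)]
  refine le_of_tendsto_of_tendsto' ((tendsto_ultralimitDiff hs hD hr g x).sub
    (tendsto_ultralimitDiff hs hD hr g y)).abs hlim fun k => ?_
  rw [← sub_div, sub_sub_sub_cancel_right]
  exact abs_rescaledDiff_le hs hr g k x y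

end Ultralimit

/-! ### Magnified copies with disjoint supports -/

section Copies

variable {X : Type*} [NormedAddCommGroup X] [NormedSpace ℝ X]

/-- The radial cutoff of the identity of `X`: equal to `z` for `‖z‖ ≤ ρ` and to `0` for
`2 * ρ ≤ ‖z‖`. -/
noncomputable def radialCutoff (ρ : ℝ) (z : X) : X := max 0 (min 1 (2 - ‖z‖ / ρ)) • z

theorem radialCutoff_of_le {ρ : ℝ} (hρ : 0 < ρ) {z : X} (hz : ‖z‖ ≤ ρ) : radialCutoff ρ z = z := by
  have h : ‖z‖ / ρ ≤ 1 := (div_le_one hρ).2 hz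
  rw [radialCutoff, min_eq_left (by linarith), max_eq_right zero_le_one, one_smul]

theorem radialCutoff_of_ge {ρ : ℝ} (hρ : 0 < ρ) {z : X} (hz : 2 * ρ ≤ ‖z‖) :
    radialCutoff ρ z = 0 := by
  have h : 2 ≤ ‖z‖ / ρ := (le_div_iff₀ hρ).2 hz
  rw [radialCutoff, max_eq_left ((min_le_right _ _).trans (by linarith)), zero_smul]

theorem norm_radialCutoff_sub_le {ρ : ℝ} (hρ : 0 < ρ) (z w : X) :
    ‖radialCutoff ρ z - radialCutoff ρ w‖ ≤ 3 * ‖z - w‖ := by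
  -- The estimate uses that the second point lies in the support of the cutoff.
  have key : ∀ z w : X, ‖w‖ ≤ 2 * ρ →
      ‖radialCutoff ρ z - radialCutoff ρ w‖ ≤ 3 * ‖z - w‖ := by
    intro z w hw
    set φ : X → ℝ := fun z => max 0 (min 1 (2 - ‖z‖ / ρ)) with hφ
    have h1 : |φ z| ≤ 1 := by
      rw [abs_of_nonneg (le_max_left _ _)]
      exact max_le zero_le_one (min_le_left _ _)
    have h2 : |φ z - φ w| * ρ ≤ ‖z - w‖ := by
      have h3 : |φ z - φ w| ≤ |(2 - ‖z‖ / ρ) - (2 - ‖w‖ / ρ)| := by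
        refine (abs_max_sub_max_le_max _ _ _ _).trans ?_
        rw [sub_self, abs_zero, max_eq_right (abs_nonneg _)]
        refine (abs_min_sub_min_le_max _ _ _ _).trans ?_
        rw [sub_self, abs_zero, max_eq_right (abs_nonneg _)]
      rw [sub_sub_sub_cancel_left, ← sub_div, abs_div, abs_of_pos hρ, le_div_iff₀ hρ] at h3
      rw [← norm_sub_rev w z]
      exact h3.trans (abs_norm_sub_norm_le w z)
    have h4 : radialCutoff ρ z - radialCutoff ρ w = φ z • (z - w) + (φ z - φ w) • w := by
      simp only [radialCutoff, hφ]
      module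
    rw [h4]
    calc ‖φ z • (z - w) + (φ z - φ w) • w‖
        ≤ |φ z| * ‖z - w‖ + |φ z - φ w| * ‖w‖ := by
          refine (norm_add_le _ _).trans ?_
          rw [norm_smul, norm_smul, Real.norm_eq_abs, Real.norm_eq_abs]
      _ ≤ 1 * ‖z - w‖ + |φ z - φ w| * (2 * ρ) := by gcongr
      _ ≤ 3 * ‖z - w‖ := by linarith
  rcases le_total ‖w‖ (2 * ρ) with hw | hw
  · exact key z w hw
  rcases le_total ‖z‖ (2 * ρ) with hz | hz
  · rw [norm_sub_rev, norm_sub_rev z]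
    exact key w z hz
  · rw [radialCutoff_of_ge hρ hw, radialCutoff_of_ge hρ hz, sub_zero, norm_zero]
    positivity

variable {p : X} {c : ℕ → X} {ρ s : ℕ → ℝ}

/-- The copy of `f` magnified by the factor `s` around `c`, cut off outside the ball of radius
`2 * ρ`. -/
noncomputable def magnifiedCopy (c : X) (ρ s : ℝ) (f : LipZero X p) (y : X) : ℝ :=
  s * f (p + s⁻¹ • radialCutoff ρ (y - c))

theorem magnifiedCopy_eq_zero {c : X} {ρ s : ℝ} (hρ : 0 < ρ) (f : LipZero X p) {y : X}
    (hy : 2 * ρ ≤ dist y c) : magnifiedCopy c ρ s f y = 0 := by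
  rw [dist_eq_norm] at hy
  rw [magnifiedCopy, radialCutoff_of_ge hρ hy, smul_zero, add_zero, f.apply_base, mul_zero]

theorem magnifiedCopy_of_le {c : X} {ρ s : ℝ} (hρ : 0 < ρ) (f : LipZero X p) {y : X}
    (hy : dist y c ≤ ρ) : magnifiedCopy c ρ s f y = s * f (p + s⁻¹ • (y - c)) := by
  rw [dist_eq_norm] at hy
  rw [magnifiedCopy, radialCutoff_of_le hρ hy]

theorem abs_magnifiedCopy_sub_le {c : X} {ρ s : ℝ} (hρ : 0 < ρ) (hs : 0 < s) (f : LipZero X p)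
    (x y : X) : |magnifiedCopy c ρ s f x - magnifiedCopy c ρ s f y| ≤ 3 * ‖f‖ * dist x y := by
  rw [magnifiedCopy, magnifiedCopy, ← mul_sub, abs_mul, abs_of_pos hs]
  have h := norm_radialCutoff_sub_le hρ (x - c) (y - c)
  rw [sub_sub_sub_cancel_right, ← dist_eq_norm x y] at h
  calc s * |f (p + s⁻¹ • radialCutoff ρ (x - c)) - f (p + s⁻¹ • radialCutoff ρ (y - c))|
      ≤ s * (‖f‖ * (s⁻¹ * ‖radialCutoff ρ (x - c) - radialCutoff ρ (y - c)‖)) := by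
        refine mul_le_mul_of_nonneg_left ((f.abs_sub_le _ _).trans_eq ?_) hs.le
        rw [dist_add_left, dist_eq_norm, ← smul_sub, norm_smul, Real.norm_eq_abs,
          abs_of_pos (inv_pos.2 hs)]
    _ = ‖f‖ * ‖radialCutoff ρ (x - c) - radialCutoff ρ (y - c)‖ := by field_simp
    _ ≤ ‖f‖ * (3 * dist x y) := mul_le_mul_of_nonneg_left h f.norm_nonneg'
    _ = 3 * ‖f‖ * dist x y := by ring

open Classical in
/-- The index of the ball `B(c k, 2 * ρ k)` that contains `y`, and `0` if there is none. For
disjoint balls the choice is unique. -/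
noncomputable def ballIndex {M : Type*} [MetricSpace M] (c : ℕ → M) (ρ : ℕ → ℝ) (y : M) : ℕ :=
  if h : ∃ k, dist y (c k) < 2 * ρ k then h.choose else 0

theorem ballIndex_eq {M : Type*} [MetricSpace M] {c : ℕ → M} {ρ : ℕ → ℝ}
    (hc : ∀ i j, i ≠ j → 2 * ρ i + 2 * ρ j ≤ dist (c i) (c j)) {y : M} {k : ℕ}
    (hk : dist y (c k) < 2 * ρ k) : ballIndex c ρ y = k := by
  have h : ∃ k, dist y (c k) < 2 * ρ k := ⟨k, hk⟩
  rw [ballIndex, dif_pos h]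
  by_contra hne
  have := h.choose_spec
  have := dist_triangle_left (c h.choose) (c k) y
  linarith [hc _ _ hne]

/-- The sum of the magnified copies of `f` in the balls `B(c k, 2 * ρ k)`, for disjoint balls. -/
noncomputable def gluedCopies (p : X) (c : ℕ → X) (ρ s : ℕ → ℝ) : LipZero X p →ₗ[ℝ] (X → ℝ) where
  toFun f y := magnifiedCopy (c (ballIndex c ρ y)) (ρ (ballIndex c ρ y)) (s (ballIndex c ρ y)) f y
  map_add' _ _ := funext fun _ => mul_add _ _ _
  map_smul' _ _ := funext fun _ => mul_left_comm _ _ _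

theorem gluedCopies_apply (f : LipZero X p) (y : X) : gluedCopies p c ρ s f y =
    magnifiedCopy (c (ballIndex c ρ y)) (ρ (ballIndex c ρ y)) (s (ballIndex c ρ y)) f y := rfl

theorem gluedCopies_of_le (hρ : ∀ k, 0 < ρ k)
    (hc : ∀ i j, i ≠ j → 2 * ρ i + 2 * ρ j ≤ dist (c i) (c j)) (f : LipZero X p) {y : X} {k : ℕ}
    (hk : dist y (c k) ≤ ρ k) :
    gluedCopies p c ρ s f y = s k * f (p + (s k)⁻¹ • (y - c k)) := by
  rw [gluedCopies_apply, ballIndex_eq hc (k := k) (by linarith [hρ k]),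
    magnifiedCopy_of_le (hρ k) f hk]

theorem abs_gluedCopies_sub_le (hρ : ∀ k, 0 < ρ k) (hs : ∀ k, 0 < s k)
    (hc : ∀ i j, i ≠ j → 2 * ρ i + 2 * ρ j ≤ dist (c i) (c j)) (f : LipZero X p) (x y : X) :
    |gluedCopies p c ρ s f x - gluedCopies p c ρ s f y| ≤ 6 * ‖f‖ * dist x y := by
  have hzero : ∀ k z, ballIndex c ρ z ≠ k → magnifiedCopy (c k) (ρ k) (s k) f z = 0 :=
    fun k z hz => magnifiedCopy_eq_zero (hρ k) f (not_lt.1 fun h => hz (ballIndex_eq hc h))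
  rw [gluedCopies_apply, gluedCopies_apply]
  generalize hi : ballIndex c ρ x = i
  generalize hj : ballIndex c ρ y = j
  have h1 := abs_magnifiedCopy_sub_le (c := c i) (hρ i) (hs i) f x y
  have h2 := abs_magnifiedCopy_sub_le (c := c j) (hρ j) (hs j) f x y
  have h0 := mul_nonneg f.norm_nonneg' (dist_nonneg (x := x) (y := y))
  rcases eq_or_ne i j with rfl | hij
  · linarith
  · rw [hzero i y (hj.trans_ne hij.symm), sub_zero] at h1
    rw [hzero j x (hi.trans_ne hij), zero_sub, abs_neg] at h2
    linarith [abs_sub (magnifiedCopy (c i) (ρ i) (s i) f x) (magnifiedCopy (c j) (ρ j) (s j) f y)]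

theorem le_dist_four_pow_smul {e : X} (he : ‖e‖ = 1) (i j : ℕ) (hij : i ≠ j) :
    2 * (4 : ℝ) ^ i + 2 * 4 ^ j ≤ dist ((4 : ℝ) ^ (i + 1) • e) ((4 : ℝ) ^ (j + 1) • e) := by
  wlog h : j < i generalizing i j
  · rw [dist_comm, add_comm]
    exact this j i hij.symm (lt_of_le_of_ne (not_lt.1 h) hij)
  have h1 : (4 : ℝ) ^ (j + 1) ≤ 4 ^ i := pow_le_pow_right₀ (by norm_num) h
  have h2 : (0 : ℝ) < 4 ^ j := by positivity
  rw [dist_eq_norm, ← sub_smul, norm_smul, he, mul_one, Real.norm_eq_abs]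
  refine le_trans ?_ (le_abs_self _)
  rw [pow_succ] at h1
  rw [pow_succ, pow_succ]
  linarith

theorem tendsto_inv_smul_of_dist_le {s : ℕ → ℝ} (hs : ∀ k, 0 < s k) (hs' : Tendsto s atTop atTop)
    {ε : ℝ} {x : X} {z c : ℕ → X} (hz : ∀ k, dist (c k + s k • (x - p)) (z k) ≤ ε) :
    Tendsto (fun k => p + (s k)⁻¹ • (z k - c k)) atTop (𝓝 x) := by
  rw [tendsto_iff_dist_tendsto_zero]
  refine squeeze_zero (fun _ => dist_nonneg) (fun k => ?_)
    ((tendsto_const_nhds (x := ε)).div_atTop hs')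
  have h : p + (s k)⁻¹ • (z k - c k) - x = (s k)⁻¹ • (z k - (c k + s k • (x - p))) := by
    rw [← sub_sub, smul_sub _ (z k - c k), smul_smul, inv_mul_cancel₀ (hs k).ne']
    module
  rw [dist_eq_norm, h, norm_smul, norm_inv, Real.norm_eq_abs, abs_of_pos (hs k), ← div_eq_inv_mul,
    ← dist_eq_norm, dist_comm]
  exact div_le_div_of_nonneg_right (hz k) (hs k).le

theorem dist_le_of_near_smul {s ε : ℝ} (hs : 0 < s) {c x y x' y' : X}
    (hx : dist (c + s • (x - p)) x' ≤ ε) (hy : dist (c + s • (y - p)) y' ≤ ε) :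
    dist x' y' ≤ s * dist x y + 2 * ε := by
  have h : dist (c + s • (x - p)) (c + s • (y - p)) = s * dist x y := by
    rw [dist_add_left, dist_smul₀, dist_sub_right, Real.norm_eq_abs, abs_of_pos hs]
  have h1 := dist_triangle4 x' (c + s • (x - p)) (c + s • (y - p)) y'
  rw [dist_comm x' (c + s • (x - p))] at h1
  linarith

theorem eventually_dist_le_four_pow {ε : ℝ} {x : X} {z c : ℕ → X}
    (hz : ∀ k, dist (c k + (2 : ℝ) ^ k • (x - p)) (z k) ≤ ε) :
    ∀ᶠ k in atTop, dist (z k) (c k) ≤ 4 ^ k := by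
  have h2 : Tendsto (fun k : ℕ => (2 : ℝ) ^ k) atTop atTop :=
    tendsto_pow_atTop_atTop_of_one_lt one_lt_two
  filter_upwards [h2.eventually_ge_atTop (‖x - p‖ + |ε|)] with k hk
  have h1 := dist_triangle_left (z k) (c k) (c k + (2 : ℝ) ^ k • (x - p))
  have h3 : dist (c k + (2 : ℝ) ^ k • (x - p)) (c k) = 2 ^ k * ‖x - p‖ := by
    rw [dist_self_add_left, norm_smul, norm_pow, Real.norm_ofNat]
  have h4 : (4 : ℝ) ^ k = 2 ^ k * 2 ^ k := by rw [← mul_pow]; norm_num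
  have h5 : (1 : ℝ) ≤ 2 ^ k := one_le_pow₀ one_le_two
  have h6 : |ε| ≤ 2 ^ k * |ε| := le_mul_of_one_le_left (abs_nonneg _) h5
  have h7 := mul_le_mul_of_nonneg_left hk (zero_le_one.trans h5)
  linarith [hz k, le_abs_self ε]

end Copies

/-! ### The retraction -/

theorem theorem3p7 {X : Type*} [NormedAddCommGroup X] [NormedSpace ℝ X] [CompleteSpace X]
    (N : Set X) (hN : IsNet N) (p : X) (q : N) :
    ∃ V : Submodule ℝ (LipZero N q),
      V.ClosedComplemented ∧ Nonempty (LipZero X p ≃L[ℝ] V) := by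
  rcases subsingleton_or_nontrivial X with hX | hX
  · refine ContinuousLinearMap.exists_closedComplemented_of_leftInverse 0 0 fun f =>
      LipZero.ext fun x => ?_
    rw [Subsingleton.elim x p, LipZero.apply_base, LipZero.apply_base]
  obtain ⟨ε, -, hε, -, hdense, -⟩ := hN
  obtain ⟨e, he⟩ := exists_norm_eq X zero_le_one
  let s : ℕ → ℝ := fun k => 2 ^ k
  let ρ : ℕ → ℝ := fun k => 4 ^ k
  let c : ℕ → X := fun k => (4 : ℝ) ^ (k + 1) • e
  have hs1 : ∀ k, 1 ≤ s k := fun k => one_le_pow₀ one_le_two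
  have hs0 : ∀ k, 0 < s k := fun k => zero_lt_one.trans_le (hs1 k)
  have hs' : Tendsto s atTop atTop := tendsto_pow_atTop_atTop_of_one_lt one_lt_two
  have hρ : ∀ k, 0 < ρ k := fun k => pow_pos four_pos k
  have hc : ∀ i j, i ≠ j → 2 * ρ i + 2 * ρ j ≤ dist (c i) (c j) := le_dist_four_pow_smul he
  have hnear : ∀ k x, ∃ y : N, dist (c k + s k • (x - p)) y ≤ ε := fun k x =>
    let ⟨y, hy, h⟩ := hdense (c k + s k • (x - p))
    ⟨⟨y, hy⟩, h⟩
  choose r hr using hnear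
  have hr' : ∀ k x y, dist (r k x) (r k y) ≤ s k * dist x y + 2 * ε := fun k x y =>
    dist_le_of_near_smul (hs0 k) (hr k x) (hr k y)
  let T : LipZero X p →L[ℝ] LipZero N q :=
    LipZero.operatorOfBound q ((LinearMap.funLeft ℝ ℝ (Subtype.val : N → X)).comp
      (gluedCopies p c ρ s)) 6 (by norm_num)
      fun f x y => abs_gluedCopies_sub_le hρ hs0 hc f x y
  let S : LipZero N q →L[ℝ] LipZero X p :=
    LipZero.operatorOfBound p (ultralimitDiff p hs1 (by positivity) hr') 1 zero_le_one
      fun g x y => abs_ultralimitDiff_sub_le hs1 hs' (by positivity) hr' g x y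
  refine ContinuousLinearMap.exists_closedComplemented_of_leftInverse T S fun f =>
    LipZero.ext fun x => ?_
  have hcont : Continuous (f : X → ℝ) := f.2.1.choose_spec.continuous
  have hlim : ∀ x, Tendsto (fun k => gluedCopies p c ρ s f (r k x) / s k) atTop (𝓝 (f x)) := by
    intro x
    refine ((hcont.tendsto x).comp (tendsto_inv_smul_of_dist_le hs0 hs' fun k => hr k x)).congr' ?_
    filter_upwards [eventually_dist_le_four_pow fun k => hr k x] with k hk
    rw [gluedCopies_of_le hρ hc f hk, mul_div_cancel_left₀ _ (hs0 k).ne']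
    rfl
  have hval : ∀ x, ultralimitDiff p hs1 (by positivity) hr' (T f) x = f x - f p := fun x =>
    tendsto_nhds_unique (tendsto_ultralimitDiff hs1 _ hr' (T f) x)
      ((((hlim x).sub (hlim p)).mono_left Nat.hyperfilter_le_atTop).congr fun k => by
        rw [← sub_div, ← sub_sub_sub_cancel_right _ _ (gluedCopies p c ρ s f q)]
        rfl)
  change ultralimitDiff p hs1 _ hr' (T f) x - ultralimitDiff p hs1 _ hr' (T f) p = f x
  rw [hval, hval, f.apply_base]
  ring
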